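/- All Hilbert spaces are finite-dimensional, $\log$ is taken to a fixed but arbitrary base $b>1$, and $A\le B$ is the Loewner order. For a Hermitian operator $A$ let $\|A\|_1=\operatorname{Tr}\sqrt{A^\dagger A}$ and $\|A\|_+=\max_{0\le M\le \mathbb 1}|\operatorname{Tr} MA|$. For a state $\rho$ and $\rho'\ge 0$ with $\operatorname{Tr}\rho'\le 1$ let $P(\rho,\rho')=\sqrt{1-\|\sqrt\rho\sqrt{\rho'}\|_1^2}$ be the purified distance. Let $D_{\max}(A\|B)=\log\inf\{\lambda\ge 0: A\le\lambda B\}$, and define $$D_{\max}^{\varepsilon,P}(\rho\|\sigma)=\inf\{D_{\max}(\rho'\|\sigma):\rho'\ge 0,\ \operatorname{Tr}\rho'\le 1,\ P(\rho,\rho')\le\varepsilon\},$$ $$D_{\max}^{\varepsilon,\mathbb M}(\rho\|\sigma)=\sup_{\mathcal M}\ \inf\{D_{\max}(p'\|\mathcal M(\sigma)): p'\ge 0,\ \textstyle\sum_i p'(i)\le 1,\ \|\mathcal M(\rho)-p'\|_+\le\varepsilon\},$$ where the supremum is over all POVMs $(M_i)_{i=1}^n$, $n\in\mathbb N$, $\mathcal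 M(\cdot)=(\operatorname{Tr}(M_i\,\cdot))_{i}$ is the vector of outcome weights, and classical vectors are identified with diagonal operators. For a bipartite state $\rho_{XE}$ with marginal $\rho_E$ and $\Delta\in\{P,\mathbb M\}$ put $$H_{\min}^{\varepsilon,\Delta,\downarrow}(X|E)_\rho=-D_{\max}^{\varepsilon,\Delta}(\rho_{XE}\|\mathbb 1_X\otimes\rho_E).$$ Let $\rho_{XE}=\sum_{x\in\mathcal X}p_X(x)|x\rangle\langle x|\otimes\rho_{E,x}$ be a classical--quantum (CQ) state, with $\mathcal X$ a finite alphabet, $p_X$ a probability distribution and $\rho_{E,x}$ states. For $f:\mathcal X\to\mathcal Z$ let $\rho^f_{ZE}=\sum_z|z\rangle\langle z|\otimes\sum_{x:f(x)=z}p_X(x)\rho_{E,x}$. The extractable randomness with trace distance error $\varepsilon$ is $$\ell_\varepsilon(\rho_{XE})=\max\Big\{\log|\mathcal Z| : \mathbb E_f\big\|\rho^f_{ZE}-\tfrac{\mathbb 1_Z}{|\mathcal Z|}\otimes\rho_E\big\|_+\le\varepsilon\Big\},$$ the maximum being over all finite output alphabets $\mathcal Z$ and all probability distributions of a random hash function $f:\mathcal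 X\to\mathcal Z$ (with no restriction on the family of functions). **Proposition.** For any CQ state $\rho_{XE}$, any $\varepsilon\in(0,1)$ and any $\delta\in(0,1-\varepsilon)$, $$\ell_\varepsilon(\rho_{XE})\ \le\ H_{\min}^{\sqrt\varepsilon,P,\downarrow}(X|E)_\rho+\log\frac1{1-\varepsilon}\ \le\ H_{\min}^{\varepsilon+\delta,\mathbb M,\downarrow}(X|E)_\rho+\log\frac{\varepsilon+\delta}{\delta}.$$ In particular, for any $k\in(1,1/\varepsilon)$, $$\ell_\varepsilon(\rho_{XE})\ \le\ H_{\min}^{k\varepsilon,\mathbb M,\downarrow}(X|E)_\rho+\log\frac{k}{k-1}.$$ -/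

import Mathlib

open scoped Matrix MatrixOrder ComplexOrder Kronecker ENNReal NNReal

namespace PrivacyAmplification

/-! Operators on the finite-dimensional Hilbert space `ℂ^d` are complex matrices indexed by a finite
type `d`; a bipartite system `AE` is indexed by `a × e`.  The order `A ≤ B` on matrices is the Loewner
order (`B - A` positive semidefinite). -/

noncomputable section

variable {d a e : Type*} [Fintype d] [DecidableEq d] [Fintype a] [DecidableEq a]
  [Fintype e] [DecidableEq e]

/-- The Schatten 1-norm `‖A‖₁ = Tr √(A† A)`. -/
def traceNorm (A : Matrix d d ℂ) : ℝ := (Matrix.trace (CFC.sqrt (Aᴴ * A))).re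

/-- `‖A‖₊ = max {|Tr M A| : 0 ≤ M ≤ 1}`, the generalised trace distance norm. -/
def plusNorm (A : Matrix d d ℂ) : ℝ :=
  sSup {r : ℝ | ∃ M : Matrix d d ℂ, 0 ≤ M ∧ M ≤ 1 ∧ r = ‖Matrix.trace (M * A)‖}

/-- The fidelity `F(ρ, ρ') = ‖√ρ √ρ'‖₁²`. -/
def fidelity (ρ ρ' : Matrix d d ℂ) : ℝ := traceNorm (CFC.sqrt ρ * CFC.sqrt ρ') ^ 2

/-- The purified distance `P(ρ, ρ') = √(1 - F(ρ, ρ'))`, for `ρ, ρ' ≥ 0` with `Tr ρ' ≤ Tr ρ = 1`. -/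
def purifiedDist (ρ ρ' : Matrix d d ℂ) : ℝ := Real.sqrt (1 - fidelity ρ ρ')

/-- The logarithm to base `b > 1` of an extended nonnegative number, with `log 0 = -∞`, `log ∞ = ∞`. -/
def elogb (b : ℝ) (x : ℝ≥0∞) : EReal := ENNReal.log x / ((Real.log b : ℝ) : EReal)

/-- The max-relative entropy `log inf {λ ≥ 0 : A ≤ λ B}` (which is `+∞` if there is no such `λ`). -/
def Dmax (b : ℝ) (A B : Matrix d d ℂ) : EReal :=
  elogb b (⨅ (l : ℝ≥0) (_ : A ≤ (l : ℝ) • B), (l : ℝ≥0∞))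

/-- The max-relative entropy smoothed in purified distance over subnormalised states. -/
def DmaxP (b ε : ℝ) (ρ σ : Matrix d d ℂ) : EReal :=
  ⨅ (ρ' : Matrix d d ℂ) (_ : 0 ≤ ρ' ∧ (Matrix.trace ρ').re ≤ 1 ∧ purifiedDist ρ ρ' ≤ ε), Dmax b ρ' σ

/-- A finite classical distribution as a diagonal operator. -/
def classicalState {n : ℕ} (p : Fin n → ℝ) : Matrix (Fin n) (Fin n) ℂ :=
  Matrix.diagonal fun i => (p i : ℂ)

/-- The max-relative entropy of classical distributions, smoothed in trace distance over classical
sub-distributions. -/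
def DmaxClassicalT (b ε : ℝ) {n : ℕ} (p q : Fin n → ℝ) : EReal :=
  ⨅ (p' : Fin n → ℝ) (_ : (∀ i, 0 ≤ p' i) ∧ ∑ i, p' i ≤ 1 ∧
      plusNorm (classicalState p - classicalState p') ≤ ε),
    Dmax b (classicalState p') (classicalState q)

/-- `(M i)` are the POVM elements of a measurement with `n` outcomes. -/
def IsPOVM {n : ℕ} (M : Fin n → Matrix d d ℂ) : Prop := (∀ i, 0 ≤ M i) ∧ ∑ i, M i = 1

/-- The classical outcome distribution `(Tr (M i A))ᵢ` of the measurement with POVM elements `M`. -/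
def outcomeDist {n : ℕ} (M : Fin n → Matrix d d ℂ) (A : Matrix d d ℂ) : Fin n → ℝ :=
  fun i => (Matrix.trace (M i * A)).re

/-- The measured smooth max-relative entropy: the supremum, over all measurements, of the classical
smooth max-relative entropy of the outcome distributions. -/
def DmaxM (b ε : ℝ) (ρ σ : Matrix d d ℂ) : EReal :=
  ⨆ (n : ℕ) (M : Fin n → Matrix d d ℂ) (_ : IsPOVM M),
    DmaxClassicalT b ε (outcomeDist M ρ) (outcomeDist M σ)

/-- The partial trace over the first system. -/
def partialTrace (R : Matrix (a × e) (a × e) ℂ) : Matrix e e ℂ :=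
  Matrix.of fun i j => ∑ x, R (x, i) (x, j)

/-- `H_min^{ε,P,↓}(A|E)_ρ = - D_max^{ε,P}(ρ_AE ‖ 1 ⊗ ρ_E)`. -/
def HminPDown (b ε : ℝ) (ρ : Matrix (a × e) (a × e) ℂ) : EReal :=
  - DmaxP b ε ρ ((1 : Matrix a a ℂ) ⊗ₖ partialTrace ρ)

/-- `H_min^{ε,M,↓}(A|E)_ρ = - D_max^{ε,M}(ρ_AE ‖ 1 ⊗ ρ_E)`. -/
def HminMDown (b ε : ℝ) (ρ : Matrix (a × e) (a × e) ℂ) : EReal :=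
  - DmaxM b ε ρ ((1 : Matrix a a ℂ) ⊗ₖ partialTrace ρ)

/-- A classical-quantum state `∑ₓ p(x) |x⟩⟨x| ⊗ ρ_{E,x}`: a probability distribution `p` on the
alphabet `X` and quantum states `ρ_{E,x}`. -/
structure CQState (X E : Type*) [Fintype X] [Fintype E] where
  p : X → ℝ
  p_nonneg : ∀ x, 0 ≤ p x
  p_sum : ∑ x, p x = 1
  ρE : X → Matrix E E ℂ
  ρE_nonneg : ∀ x, 0 ≤ ρE x
  ρE_trace : ∀ x, Matrix.trace (ρE x) = 1

namespace CQState

variable {X E : Type*} [Fintype X] [DecidableEq X] [Fintype E] [DecidableEq E]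

/-- The operator `ρ_XE = ∑ₓ p(x) |x⟩⟨x| ⊗ ρ_{E,x}`. -/
def toMatrix (ρ : CQState X E) : Matrix (X × E) (X × E) ℂ :=
  ∑ x, Matrix.single x x (1 : ℂ) ⊗ₖ (ρ.p x • ρ.ρE x)

/-- The hashed operator `ρ_ZE^f = ∑_z |z⟩⟨z| ⊗ ∑_{x : f(x) = z} p(x) ρ_{E,x}`, with `Z = {0,…,n-1}`. -/
def hashed (ρ : CQState X E) {n : ℕ} (f : X → Fin n) : Matrix (Fin n × E) (Fin n × E) ℂ :=
  ∑ z, Matrix.single z z (1 : ℂ) ⊗ₖ ∑ x with f x = z, ρ.p x • ρ.ρE x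

/-- The security error `‖ρ_ZE^f - (1_Z / |Z|) ⊗ ρ_E‖₊` of the hash function `f`. -/
def hashError (ρ : CQState X E) {n : ℕ} (f : X → Fin n) : ℝ :=
  plusNorm (ρ.hashed f - ((n : ℝ)⁻¹ • (1 : Matrix (Fin n) (Fin n) ℂ)) ⊗ₖ partialTrace ρ.toMatrix)

/-- An alphabet of size `n` is extractable with error `ε` if some random hash function `f : X → Z`,
`|Z| = n`, with an arbitrary distribution `μ`, has expected error at most `ε`. -/
def Extractable (ε : ℝ) (ρ : CQState X E) (n : ℕ) : Prop :=
  ∃ μ : PMF (X → Fin n), ∑ f, (μ f).toReal * ρ.hashError f ≤ ε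

/-- The extractable randomness `ℓ_ε(ρ_XE)`: the largest `log |Z|` over all extractable alphabet sizes. -/
def extractableRandomness (b ε : ℝ) (ρ : CQState X E) : EReal :=
  sSup {L : EReal | ∃ n : ℕ, ρ.Extractable ε n ∧ L = ((Real.logb b n : ℝ) : EReal)}

end CQState

end

end PrivacyAmplification

/-! The two maxima in the definitions are attained. -/

namespace PrivacyAmplification

theorem norm_entry_le {d : Type*} [Fintype d] [DecidableEq d] {M : Matrix d d ℂ}
    (h0 : 0 ≤ M) (h1 : M ≤ 1) (i j : d) : ‖M i j‖ ≤ Fintype.card d := by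
  obtain ⟨B, rfl⟩ := CStarAlgebra.nonneg_iff_eq_star_mul_self.mp h0
  have hB : ∀ k i, ‖B k i‖ ≤ 1 := by
    intro k i
    have hd := (Matrix.le_iff.mp h1).diag_nonneg (i := i)
    have he : (star B * B) i i = ((∑ k, ‖B k i‖ ^ 2 : ℝ) : ℂ) := by
      rw [Matrix.mul_apply]
      push_cast
      refine Finset.sum_congr rfl fun k _ => ?_
      rw [Matrix.star_apply, ← Complex.conj_mul']
      rfl
    rw [Matrix.sub_apply, he, Matrix.one_apply_eq] at hd
    have hd' : (∑ k, ‖B k i‖ ^ 2 : ℝ) ≤ 1 := by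
      have : (0 : ℂ) ≤ ((1 - ∑ k, ‖B k i‖ ^ 2 : ℝ) : ℂ) := by simpa using hd
      have := Complex.zero_le_real.mp this
      linarith
    have := Finset.single_le_sum (f := fun k => ‖B k i‖ ^ 2) (fun k _ => by positivity)
      (Finset.mem_univ k)
    have h2 : ‖B k i‖ ^ 2 ≤ 1 := le_trans this hd'
    nlinarith [norm_nonneg (B k i)]
  rw [Matrix.mul_apply]
  refine (norm_sum_le _ _).trans ?_
  calc _ ≤ ∑ _k : d, (1 : ℝ) := Finset.sum_le_sum fun k _ => by
        rw [norm_mul, Matrix.star_apply, norm_star]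
        exact mul_le_one₀ (hB _ _) (norm_nonneg _) (hB _ _)
    _ = _ := by simp

/-- The maximum defining `‖A‖₊` is attained. -/
theorem plusNorm_isGreatest {d : Type*} [Fintype d] [DecidableEq d] (A : Matrix d d ℂ) :
    IsGreatest {r : ℝ | ∃ M : Matrix d d ℂ, 0 ≤ M ∧ M ≤ 1 ∧ r = ‖Matrix.trace (M * A)‖}
      (plusNorm A) := by
  have hcl : ∀ C : Matrix d d ℂ, ∀ s : ℝ,
      IsClosed {M : Matrix d d ℂ | 0 ≤ C + s • M} := by
    intro C s
    have : {M : Matrix d d ℂ | 0 ≤ C + s • M} =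
        {M | (C + s • M)ᴴ = C + s • M} ∩
          ⋂ x : d → ℂ, {M | 0 ≤ star x ⬝ᵥ ((C + s • M) *ᵥ x)} := by
      ext M
      simp only [Set.mem_ofPred_eq, Set.mem_inter_iff, Set.mem_iInter]
      rw [Matrix.nonneg_iff_posSemidef, Matrix.posSemidef_iff_dotProduct_mulVec]
      rfl
    rw [this]
    refine (isClosed_eq (by fun_prop) (by fun_prop)).inter
      (isClosed_iInter fun x => isClosed_le continuous_const ?_)
    exact Continuous.dotProduct continuous_const (Continuous.matrix_mulVec (by fun_prop) continuous_const)
  have hc : IsCompact {M : Matrix d d ℂ | 0 ≤ M ∧ M ≤ 1} := by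
    have hcl' : IsClosed {M : Matrix d d ℂ | 0 ≤ M ∧ M ≤ 1} := by
      have h1 := (hcl 0 1).inter (hcl 1 (-1))
      convert h1 using 1
      ext M
      simp [← sub_eq_add_neg]
    refine IsCompact.of_isClosed_subset (isCompact_univ_pi fun i : d => isCompact_univ_pi fun j : d =>
      ProperSpace.isCompact_closedBall (0 : ℂ) (Fintype.card d)) hcl' ?_
    intro M hM i _ j _
    simpa using norm_entry_le hM.1 hM.2 i j
  have : {r : ℝ | ∃ M : Matrix d d ℂ, 0 ≤ M ∧ M ≤ 1 ∧ r = ‖Matrix.trace (M * A)‖} =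
      (fun M : Matrix d d ℂ => ‖Matrix.trace (M * A)‖) '' {M : Matrix d d ℂ | 0 ≤ M ∧ M ≤ 1} := by
    ext r
    constructor
    · rintro ⟨M, h0, h1, rfl⟩; exact ⟨M, ⟨h0, h1⟩, rfl⟩
    · rintro ⟨M, ⟨h0, h1⟩, rfl⟩; exact ⟨M, h0, h1, rfl⟩
  rw [plusNorm, this]
  exact (hc.image (by fun_prop)).isGreatest_sSup ⟨_, ⟨0, ⟨le_rfl, zero_le_one⟩, rfl⟩⟩

namespace CQState

variable {X E : Type*} [Fintype X] [DecidableEq X] [Fintype E] [DecidableEq E]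

theorem partialTrace_toMatrix (ρ : CQState X E) :
    partialTrace ρ.toMatrix = ∑ x, ρ.p x • ρ.ρE x := by
  ext i j
  simp [partialTrace, toMatrix, Matrix.sum_apply, Matrix.single_apply, Matrix.kroneckerMap_apply]

theorem le_hashError (ρ : CQState X E) {n : ℕ} (f : X → Fin n) :
    1 - (Fintype.card X : ℝ) / n ≤ ρ.hashError f := by
  set g : Fin n → ℂ := fun z => if z ∈ Finset.univ.image f then 1 else 0 with hg
  have hM0 : (0 : Matrix (Fin n × E) (Fin n × E) ℂ) ≤ Matrix.diagonal (fun z => g z.1) := by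
    rw [Matrix.nonneg_iff_posSemidef, Matrix.posSemidef_diagonal_iff]
    intro z
    simp only [hg]
    split_ifs <;> simp
  have hM1 : Matrix.diagonal (fun z : Fin n × E => g z.1) ≤ 1 := by
    rw [Matrix.le_iff, ← Matrix.diagonal_one, Matrix.diagonal_sub, Matrix.posSemidef_diagonal_iff]
    intro z
    simp only [hg]
    split_ifs <;> simp
  refine le_trans ?_ ((plusNorm_isGreatest _).2 ⟨_, hM0, hM1, rfl⟩)
  have ht : ∑ x, ρ.p x • Matrix.trace (ρ.ρE x) = 1 := by
    simp only [ρ.ρE_trace]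
    rw [← Finset.sum_smul, ρ.p_sum, one_smul]
  have h1 : Matrix.trace (Matrix.diagonal (fun z : Fin n × E => g z.1) * ρ.hashed f) = 1 := by
    have : Matrix.trace (Matrix.diagonal (fun z : Fin n × E => g z.1) * ρ.hashed f) =
        ∑ z, g z * ∑ x with f x = z, ρ.p x • Matrix.trace (ρ.ρE x) := by
      simp only [Matrix.trace, Matrix.diag, Matrix.diagonal_mul, Fintype.sum_prod_type]
      refine Finset.sum_congr rfl fun z _ => ?_
      rw [← Finset.mul_sum]
      congr 1
      simp only [hashed, Matrix.sum_apply, Matrix.kroneckerMap_apply, Matrix.single_apply,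
        and_self, ite_mul, one_mul, zero_mul, Finset.sum_ite_eq', Finset.mem_univ, if_true,
        Matrix.smul_apply, Finset.smul_sum]
      rw [Finset.sum_comm]
    rw [this, ← ht, ← Finset.sum_fiberwise (s := Finset.univ) (g := f)]
    refine Finset.sum_congr rfl fun z _ => ?_
    by_cases hz : z ∈ Finset.univ.image f
    · rw [hg]; dsimp only; rw [if_pos hz, one_mul]
    · simp only [hg, hz, if_false, zero_mul]
      rw [Finset.sum_eq_zero]
      intro x hx
      exact absurd (by simpa using ⟨x, (Finset.mem_filter.mp hx).2⟩) hz
  have h2 : Matrix.trace (Matrix.diagonal (fun z : Fin n × E => g z.1) *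
      (((n : ℝ)⁻¹ • (1 : Matrix (Fin n) (Fin n) ℂ)) ⊗ₖ partialTrace ρ.toMatrix)) =
      (((Finset.univ.image f).card / n : ℝ) : ℂ) := by
    have htr : ∑ i, partialTrace ρ.toMatrix i i = 1 := by
      rw [← ht, partialTrace_toMatrix]
      simp only [Matrix.trace, Matrix.diag, Matrix.sum_apply, Matrix.smul_apply, Finset.smul_sum]
      rw [Finset.sum_comm]
    simp only [Matrix.trace, Matrix.diag, Matrix.diagonal_mul, Fintype.sum_prod_type,
      Matrix.kroneckerMap_apply, Matrix.smul_apply, Matrix.one_apply_eq, ← Finset.mul_sum, htr]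
    have hgs : ∑ z, g z = ((Finset.univ.image f).card : ℂ) := by
      rw [hg, Finset.sum_ite_mem, Finset.univ_inter, Finset.sum_const, nsmul_eq_mul, mul_one]
    simp only [Complex.real_smul, mul_one, ← Finset.sum_mul, hgs]
    push_cast
    rw [div_eq_mul_inv]
  rw [Matrix.mul_sub, Matrix.trace_sub, h1, h2]
  rw [show (1 : ℂ) = ((1 : ℝ) : ℂ) by simp, ← Complex.ofReal_sub, Complex.norm_real]
  refine le_trans ?_ (le_abs_self _)
  have : (Finset.univ.image f).card ≤ Fintype.card X := Finset.card_image_le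
  gcongr

theorem Extractable.le {ε : ℝ} {ρ : CQState X E} {n : ℕ} (hε : ε < 1) (h : ρ.Extractable ε n) :
    (n : ℝ) ≤ Fintype.card X / (1 - ε) := by
  obtain ⟨μ, hμ⟩ := h
  have hs : ∑ f, (μ f).toReal = 1 := by
    rw [← ENNReal.toReal_sum fun f _ => μ.apply_ne_top f, ← tsum_fintype (L := .unconditional _), μ.tsum_coe,
      ENNReal.toReal_one]
  have : 1 - (Fintype.card X : ℝ) / n ≤ ε := by
    refine le_trans ?_ hμ
    calc _ = ∑ f, (μ f).toReal * (1 - (Fintype.card X : ℝ) / n) := by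
          rw [← Finset.sum_mul, hs, one_mul]
      _ ≤ _ := Finset.sum_le_sum fun f _ =>
          mul_le_mul_of_nonneg_left (ρ.le_hashError f) ENNReal.toReal_nonneg
  rcases Nat.eq_zero_or_pos n with rfl | hn
  · simp only [Nat.cast_zero]
    have : 0 < 1 - ε := by linarith
    positivity
  · have hn' : (0 : ℝ) < n := by exact_mod_cast hn
    rw [le_div_iff₀ (by linarith)]
    have h3 : 1 - ε ≤ (Fintype.card X : ℝ) / n := by linarith
    rw [le_div_iff₀ hn'] at h3
    linarith

theorem extractable_one {ε : ℝ} (hε : 0 ≤ ε) (ρ : CQState X E) : ρ.Extractable ε 1 := by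
  refine ⟨PMF.pure fun _ => 0, ?_⟩
  have h : ∀ f : X → Fin 1, ρ.hashError f = 0 := by
    intro f
    have : ρ.hashed f - (((1 : ℕ) : ℝ)⁻¹ • (1 : Matrix (Fin 1) (Fin 1) ℂ)) ⊗ₖ
        partialTrace ρ.toMatrix = 0 := by
      rw [partialTrace_toMatrix]
      ext ⟨z, i⟩ ⟨w, j⟩
      obtain rfl : z = 0 := Subsingleton.elim _ _
      obtain rfl : w = 0 := Subsingleton.elim _ _
      have : ∀ x, f x = 0 := fun x => Subsingleton.elim _ _
      simp [hashed, this]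
    rw [hashError, this]
    obtain ⟨M, -, -, h⟩ := (plusNorm_isGreatest (0 : Matrix (Fin 1 × E) (Fin 1 × E) ℂ)).1
    rw [h]; simp
  simp [h, hε]

/-- The maximum defining the extractable randomness is attained for every error `0 ≤ ε < 1`. -/
theorem extractableRandomness_isGreatest {b ε : ℝ} (h0 : 0 ≤ ε) (h1 : ε < 1)
    (ρ : CQState X E) :
    IsGreatest {L : EReal | ∃ n : ℕ, ρ.Extractable ε n ∧ L = ((Real.logb b n : ℝ) : EReal)}
      (ρ.extractableRandomness b ε) := by
  have hfin : {n : ℕ | ρ.Extractable ε n}.Finite :=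
    (Set.finite_Iic ⌊(Fintype.card X : ℝ) / (1 - ε)⌋₊).subset fun n hn => Nat.le_floor (hn.le h1)
  have heq : {L : EReal | ∃ n : ℕ, ρ.Extractable ε n ∧ L = ((Real.logb b n : ℝ) : EReal)} =
      (fun n : ℕ => ((Real.logb b n : ℝ) : EReal)) '' {n : ℕ | ρ.Extractable ε n} := by
    ext L
    constructor
    · rintro ⟨n, hn, rfl⟩; exact ⟨n, hn, rfl⟩
    · rintro ⟨n, hn, rfl⟩; exact ⟨n, hn, rfl⟩
  rw [extractableRandomness, heq]
  refine ⟨Set.Nonempty.csSup_mem ⟨_, 1, ρ.extractable_one h0, rfl⟩ (hfin.image _), fun L hL => ?_⟩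
  exact le_sSup hL

end CQState

end PrivacyAmplification

open PrivacyAmplification

/-! First inequality. Averaging gives one hash function `f` onto `n` values with error at most `ε`.
Write `ρ_z` for the block of the hashed state at `z`, `A = ρ_E / n`, and `Q_z` for the positive part
of `ρ_z - A`. Testing with the projections onto these positive parts shows that the total trace of
the `Q_z` is at most `ε`. Since `ρ_z ≤ S_z = A + Q_z`, a solution `0 ≤ G_z ≤ 1` of `G_z S_z G_z = A`
(`exists_riccati`) compresses every `p(x) ρ_{E,x}` with `f(x) = z` below `A`, and it loses trace at
most `Tr (1 - G_z²) S_z = Tr Q_z`. So the block-diagonal test `G = ⊕ₓ G_{f(x)}` sends the state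
below `1 ⊗ ρ_E / n` while keeping trace `t ≥ 1 - ε`. Normalising `GρG` costs the factor `1 / (1 -
ε)`, and the sharp gentle measurement bound `√F(ρ, GρG) ≥ Tr Gρ ≥ t` gives fidelity at least `t`,
hence purified distance at most `√ε`.

Second inequality. This holds for any state and any `σ`. Measuring a nearby `τ ≤ l σ` does not
decrease the fidelity, so the outcome weights `p` of `ρ` and `q` of `τ` have fidelity at least `1 -
ε`. With `η` the larger error and `c = (1 - ε) η / (η - ε)`, truncating `p` to `min(p, c q)` removes
mass at most `η` (`sum_sub_min_le`, a weighted Cauchy–Schwarz inequality) and leaves something below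
`c l` times the outcome weights of `σ`. The factor `1 - ε` in `c` cancels the normalisation factor
of the first part. -/

namespace PrivacyAmplification

/-! ### Matrix inequalities: polar decomposition, fidelity, Riccati equation, positive part. -/

section MatrixLemmas

variable {d : Type*}

theorem conjTranspose_of_nonneg {A : Matrix d d ℂ} (hA : 0 ≤ A) : Aᴴ = A :=
  (Matrix.nonneg_iff_posSemidef.mp hA).1

variable [Fintype d]

theorem trace_nonneg_of_nonneg {A : Matrix d d ℂ} (hA : 0 ≤ A) : 0 ≤ A.trace :=
  (Matrix.nonneg_iff_posSemidef.mp hA).trace_nonneg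

theorem re_trace_conjTranspose_mul_self (X : Matrix d d ℂ) :
    (Xᴴ * X).trace.re = ∑ i, ∑ j, ‖X j i‖ ^ 2 := by
  simp only [Matrix.trace, Matrix.diag, Matrix.mul_apply, Matrix.conjTranspose_apply, Complex.re_sum]
  refine Finset.sum_congr rfl fun i _ => Finset.sum_congr rfl fun j _ => ?_
  have : star (X j i) * X j i = ((‖X j i‖ ^ 2 : ℝ) : ℂ) := by
    rw [Complex.ofReal_pow, ← Complex.conj_mul']; rfl
  rw [this, Complex.ofReal_re]

variable [DecidableEq d]

theorem sqrt_mul_sqrt {A : Matrix d d ℂ} (hA : 0 ≤ A) : CFC.sqrt A * CFC.sqrt A = A :=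
  CFC.sqrt_mul_sqrt_self A hA

theorem trace_mul_nonneg {A B : Matrix d d ℂ} (hA : 0 ≤ A) (hB : 0 ≤ B) :
    0 ≤ (A * B).trace := by
  have h := trace_nonneg_of_nonneg (conjugate_nonneg_of_nonneg hA (CFC.sqrt_nonneg B))
  rwa [Matrix.mul_assoc, Matrix.trace_mul_comm, Matrix.mul_assoc, sqrt_mul_sqrt hB] at h

theorem re_trace_mul_nonneg {A B : Matrix d d ℂ} (hA : 0 ≤ A) (hB : 0 ≤ B) :
    0 ≤ (A * B).trace.re := by
  simpa using (Complex.le_def.mp (trace_mul_nonneg hA hB)).1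

theorem re_trace_mul_le_mul_left {A B C : Matrix d d ℂ} (hAB : A ≤ B) (hC : 0 ≤ C) :
    (C * A).trace.re ≤ (C * B).trace.re := by
  have := re_trace_mul_nonneg hC (sub_nonneg.mpr hAB)
  rw [Matrix.mul_sub, Matrix.trace_sub, Complex.sub_re] at this
  linarith

/-- The Cauchy–Schwarz inequality for the Hilbert–Schmidt inner product. -/
theorem norm_trace_conjTranspose_mul_le (X Y : Matrix d d ℂ) :
    ‖(Xᴴ * Y).trace‖ ≤ √((Xᴴ * X).trace.re) * √((Yᴴ * Y).trace.re) := by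
  rw [← Real.sqrt_mul (by rw [re_trace_conjTranspose_mul_self]; positivity)]
  refine Real.le_sqrt_of_sq_le ?_
  rw [re_trace_conjTranspose_mul_self, re_trace_conjTranspose_mul_self]
  simp only [← Fintype.sum_prod_type']
  refine le_trans ?_ (Finset.sum_mul_sq_le_sq_mul_sq _ _ _)
  gcongr
  simp only [Matrix.trace, Matrix.diag, Matrix.mul_apply, Matrix.conjTranspose_apply]
  rw [← Fintype.sum_prod_type' (f := fun i j => star (X j i) * Y j i)]
  refine (norm_sum_le _ _).trans (Finset.sum_le_sum fun k _ => ?_)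
  rw [norm_mul, norm_star]

theorem norm_trace_mul_le (X Y : Matrix d d ℂ) :
    ‖(X * Y).trace‖ ≤ √((X * Xᴴ).trace.re) * √((Yᴴ * Y).trace.re) := by
  simpa using norm_trace_conjTranspose_mul_le Xᴴ Y

/-- Functional calculus of `x⁻¹` with the convention `0⁻¹ = 0`; then `g * H` is the support
projection of `H`. -/
theorem exists_pseudoinverse {H : Matrix d d ℂ} (hH : 0 ≤ H) :
    ∃ g : Matrix d d ℂ, 0 ≤ g ∧ g * H = H * g ∧ g * H ≤ 1 ∧ H * g * H = H := by
  have hsa : IsSelfAdjoint H := IsSelfAdjoint.of_nonneg hH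
  have hc : ∀ f : ℝ → ℝ, ContinuousOn f (spectrum ℝ H) := fun f =>
    (Matrix.finite_real_spectrum (A := H)).continuousOn f
  have hid : cfc (fun x : ℝ => x) H = H := cfc_id' ℝ H
  have hm : ∀ f : ℝ → ℝ, cfc f H * H = cfc (fun x => f x * x) H := fun f => by
    rw [cfc_mul f (fun x => x) H (hc _) (hc _), hid]
  have hm' : ∀ f : ℝ → ℝ, H * cfc f H = cfc (fun x => x * f x) H := fun f => by
    rw [cfc_mul (fun x => x) f H (hc _) (hc _), hid]
  refine ⟨cfc (fun x : ℝ => x⁻¹) H, cfc_nonneg fun x hx => ?_, ?_, ?_, ?_⟩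
  · exact inv_nonneg.mpr (spectrum_nonneg_of_nonneg hH hx)
  · rw [hm, hm']
    simp only [mul_comm]
  · rw [hm]
    refine cfc_le_one _ _ fun x _ => ?_
    exact inv_mul_le_one
  · rw [hm', hm]
    simp only [mul_inv_mul_cancel, hid]

/-- A polar decomposition `A = V √(A† A)` with a contraction `V`. -/
theorem exists_polar (A : Matrix d d ℂ) :
    ∃ V : Matrix d d ℂ, Vᴴ * V ≤ 1 ∧ A = V * CFC.sqrt (Aᴴ * A) ∧ Vᴴ * A = CFC.sqrt (Aᴴ * A) := by
  have hAA : 0 ≤ Aᴴ * A :=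
    Matrix.nonneg_iff_posSemidef.mpr (Matrix.posSemidef_conjTranspose_mul_self A)
  have hHH := sqrt_mul_sqrt hAA
  have hH := CFC.sqrt_nonneg (Aᴴ * A)
  generalize CFC.sqrt (Aᴴ * A) = H at hHH hH ⊢
  obtain ⟨g, hg, hcomm, hle, hHgH⟩ := exists_pseudoinverse hH
  have hgs := conjTranspose_of_nonneg hg
  have hHs := conjTranspose_of_nonneg hH
  have hgHH : g * H * H = H := by rw [hcomm, hHgH]
  -- `A |A|⁻¹`, with the inverse taken on the support of `|A|`: then `Vᴴ * V` is the support
  -- projection `g * H`, and `A` vanishes on the kernel of `|A|`.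
  refine ⟨A * g, ?_, ?_, ?_⟩
  · have : (A * g)ᴴ * (A * g) = g * H := by
      rw [Matrix.conjTranspose_mul, hgs, Matrix.mul_assoc, ← Matrix.mul_assoc Aᴴ, ← hHH,
        ← Matrix.mul_assoc, ← Matrix.mul_assoc, hgHH, hcomm]
    rwa [this]
  · have h0 : H * (1 - g * H) = 0 := by
      rw [Matrix.mul_sub, Matrix.mul_one, ← Matrix.mul_assoc, hHgH, sub_self]
    have h1 : A * (1 - g * H) = 0 := by
      rw [← Matrix.conjTranspose_mul_self_eq_zero, Matrix.conjTranspose_mul, Matrix.mul_assoc,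
        ← Matrix.mul_assoc Aᴴ, ← hHH, Matrix.mul_assoc H, h0, Matrix.mul_zero, Matrix.mul_zero]
    rw [Matrix.mul_sub, Matrix.mul_one, sub_eq_zero, ← Matrix.mul_assoc] at h1
    exact h1
  · rw [Matrix.conjTranspose_mul, hgs, Matrix.mul_assoc, ← hHH, ← Matrix.mul_assoc, hgHH]

/-- With `A = V R²` and `R = √|A|`, the trace of `U A` pairs `R U` with `V R`. Both have squared
Hilbert–Schmidt norm at most `Tr |A|`, so Cauchy–Schwarz applies. -/
theorem norm_trace_mul_le_traceNorm {U : Matrix d d ℂ} (hU : U * Uᴴ ≤ 1) (A : Matrix d d ℂ) :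
    ‖(U * A).trace‖ ≤ traceNorm A := by
  obtain ⟨V, hV, hA, -⟩ := exists_polar A
  rw [traceNorm]
  have hH := CFC.sqrt_nonneg (Aᴴ * A)
  generalize CFC.sqrt (Aᴴ * A) = H at hA hH ⊢
  have hR := CFC.sqrt_nonneg H
  have hRR := sqrt_mul_sqrt hH
  generalize CFC.sqrt H = R at hR hRR
  have hRs := conjTranspose_of_nonneg hR
  have h1 : (U * A).trace = ((R * U) * (V * R)).trace := by
    rw [hA, ← hRR, ← Matrix.mul_assoc, ← Matrix.mul_assoc, Matrix.trace_mul_comm]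
    simp only [Matrix.mul_assoc]
  have hpos : ∀ W : Matrix d d ℂ, W ≤ 1 → (R * W * R).trace.re ≤ H.trace.re := by
    intro W hW
    have := re_trace_mul_le_mul_left hW hH
    rwa [Matrix.mul_one, ← hRR, Matrix.mul_assoc, Matrix.trace_mul_comm, hRR] at this
  rw [h1]
  refine (norm_trace_mul_le _ _).trans ?_
  have e1 : (R * U) * (R * U)ᴴ = R * (U * Uᴴ) * R := by
    simp only [Matrix.conjTranspose_mul, hRs, Matrix.mul_assoc]
  have e2 : (V * R)ᴴ * (V * R) = R * (Vᴴ * V) * R := by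
    simp only [Matrix.conjTranspose_mul, hRs, Matrix.mul_assoc]
  rw [e1, e2]
  have h0 : 0 ≤ H.trace.re := by
    simpa using (Complex.le_def.mp (trace_nonneg_of_nonneg hH)).1
  calc _ ≤ √(H.trace.re) * √(H.trace.re) :=
        mul_le_mul (Real.sqrt_le_sqrt (hpos _ hU)) (Real.sqrt_le_sqrt (hpos _ hV))
          (Real.sqrt_nonneg _) (Real.sqrt_nonneg _)
    _ = _ := Real.mul_self_sqrt h0

/-- The tightened gentle measurement bound `√F(ρ, GρG) ≥ Tr Gρ`. -/
theorem re_trace_mul_le_traceNorm_sqrt {ρ G : Matrix d d ℂ} (hρ : 0 ≤ ρ) (hG : 0 ≤ G) :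
    (G * ρ).trace.re ≤ traceNorm (CFC.sqrt ρ * CFC.sqrt (G * ρ * G)) := by
  have hR := CFC.sqrt_nonneg ρ
  have hRR := sqrt_mul_sqrt hρ
  generalize CFC.sqrt ρ = R at hR hRR ⊢
  have hRs := conjTranspose_of_nonneg hR
  have hGs := conjTranspose_of_nonneg hG
  -- The modulus of `√ρ G` is `T = √(GρG)`, so `Tr Gρ = Tr Vᴴ √ρ T`, which the trace norm of `√ρ T`
  -- bounds.
  obtain ⟨V, hV, h1, -⟩ := exists_polar (R * G)
  have e : (R * G)ᴴ * (R * G) = G * ρ * G := by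
    rw [Matrix.conjTranspose_mul, hRs, hGs, ← hRR]
    simp only [Matrix.mul_assoc]
  rw [e] at h1
  have hTs := conjTranspose_of_nonneg (CFC.sqrt_nonneg (G * ρ * G))
  generalize CFC.sqrt (G * ρ * G) = T at h1 hTs ⊢
  have h2 : G * R = T * Vᴴ := by
    have := congrArg Matrix.conjTranspose h1
    rwa [Matrix.conjTranspose_mul, Matrix.conjTranspose_mul, hRs, hGs, hTs] at this
  have h3 : (G * ρ).trace = (Vᴴ * (R * T)).trace := by
    rw [← hRR, ← Matrix.mul_assoc, h2, Matrix.trace_mul_comm, ← Matrix.mul_assoc,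
      Matrix.trace_mul_comm]
  rw [h3]
  exact (Complex.re_le_norm _).trans (norm_trace_mul_le_traceNorm (by simpa using hV) _)

/-- The fidelity does not decrease under measurements. -/
theorem traceNorm_sqrt_mul_sqrt_le {n : ℕ} {M : Fin n → Matrix d d ℂ} (hM : IsPOVM M)
    {ρ τ : Matrix d d ℂ} (hρ : 0 ≤ ρ) (hτ : 0 ≤ τ) :
    traceNorm (CFC.sqrt ρ * CFC.sqrt τ) ≤
      ∑ i, √(outcomeDist M ρ i) * √(outcomeDist M τ i) := by
  have hRs := conjTranspose_of_nonneg (CFC.sqrt_nonneg ρ)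
  have hRR := sqrt_mul_sqrt hρ
  have hTs := conjTranspose_of_nonneg (CFC.sqrt_nonneg τ)
  have hTT := sqrt_mul_sqrt hτ
  generalize CFC.sqrt ρ = R at hRs hRR ⊢
  generalize CFC.sqrt τ = T at hTs hTT ⊢
  obtain ⟨V, hV, -, h1⟩ := exists_polar (R * T)
  rw [traceNorm, ← h1]
  -- Inserting `∑ M i = 1` splits the trace norm by outcome; Cauchy–Schwarz with `√(M i)` on each
  -- side bounds each summand.
  have h2 : Vᴴ * (R * T) = ∑ i, Vᴴ * (R * M i * T) := by
    rw [← Matrix.mul_sum, ← Matrix.sum_mul, ← Matrix.mul_sum, hM.2, Matrix.mul_one]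
  rw [h2, Matrix.trace_sum, Complex.re_sum]
  refine Finset.sum_le_sum fun i _ => (Complex.re_le_norm _).trans ?_
  have hK := sqrt_mul_sqrt (hM.1 i)
  have hK0 := CFC.sqrt_nonneg (M i)
  rw [outcomeDist, outcomeDist]
  have hMi := hM.1 i
  generalize M i = N at hK hK0 hMi ⊢
  generalize CFC.sqrt N = K at hK hK0
  have hKs := conjTranspose_of_nonneg hK0
  have e : (Vᴴ * (R * N * T)).trace = ((K * T * Vᴴ) * (R * K)).trace := by
    rw [← hK, Matrix.trace_mul_comm, ← Matrix.mul_assoc, ← Matrix.mul_assoc, Matrix.mul_assoc,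
      Matrix.mul_assoc, Matrix.trace_mul_comm]
    simp only [Matrix.mul_assoc]
  rw [e, mul_comm]
  refine (norm_trace_mul_le _ _).trans (mul_le_mul (Real.sqrt_le_sqrt ?_) (Real.sqrt_le_sqrt ?_)
    (Real.sqrt_nonneg _) (Real.sqrt_nonneg _))
  · have e3 : (K * T * Vᴴ) * (K * T * Vᴴ)ᴴ = (K * T) * ((Vᴴ * V) * (K * T)ᴴ) := by
      simp only [Matrix.conjTranspose_mul, Matrix.conjTranspose_conjTranspose, Matrix.mul_assoc]
    have e4 : (N * τ).trace = ((K * T)ᴴ * (K * T)).trace := by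
      rw [Matrix.conjTranspose_mul, hKs, hTs, ← hK, ← hTT, Matrix.mul_assoc T, Matrix.trace_mul_comm T]
      simp only [Matrix.mul_assoc]
    rw [e3, e4, Matrix.trace_mul_comm (K * T), Matrix.mul_assoc, Matrix.trace_mul_comm]
    have h := re_trace_mul_le_mul_left hV
      (C := (K * T)ᴴ * (K * T))
      (Matrix.nonneg_iff_posSemidef.mpr (Matrix.posSemidef_conjTranspose_mul_self _))
    rwa [Matrix.mul_one] at h
  · refine le_of_eq ?_
    have e5 : (R * K)ᴴ * (R * K) = K * ρ * K := by
      rw [Matrix.conjTranspose_mul, hKs, hRs, ← hRR]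
      simp only [Matrix.mul_assoc]
    rw [e5, Matrix.trace_mul_comm, ← Matrix.mul_assoc, hK]

/-- The Riccati equation `G S G = A` with `0 ≤ A ≤ S` has a solution `0 ≤ G ≤ 1`
(the geometric mean of `A` and the pseudoinverse of `S`). -/
theorem exists_riccati {A S : Matrix d d ℂ} (hA : 0 ≤ A) (hAS : A ≤ S) :
    ∃ G : Matrix d d ℂ, 0 ≤ G ∧ G ≤ 1 ∧ G * S * G = A := by
  have hS := hA.trans hAS
  have hH0 := CFC.sqrt_nonneg S
  have hHH := sqrt_mul_sqrt hS
  generalize CFC.sqrt S = H at hH0 hHH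
  obtain ⟨g, hg, hcomm, hle, hHgH⟩ := exists_pseudoinverse hH0
  have hHs := conjTranspose_of_nonneg hH0
  have hgs := conjTranspose_of_nonneg hg
  -- The projection onto the kernel of `S`. Since `A` and `R` vanish there, the support projections
  -- `H * g` can be dropped, and `g` acts as `S^{-1/2}`.
  set Q := 1 - H * g with hQ
  have hQs : Qᴴ = Q := by
    rw [hQ, Matrix.conjTranspose_sub, Matrix.conjTranspose_mul, hHs, hgs, hcomm,
      Matrix.conjTranspose_one]
  have hHQ : H * Q = 0 := by
    rw [hQ, ← hcomm, Matrix.mul_sub, Matrix.mul_one, ← Matrix.mul_assoc, hHgH, sub_self]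
  have hB : 0 ≤ H * A * H := conjugate_nonneg_of_nonneg hA hH0
  have hBle : H * A * H ≤ S * S := by
    have := conjugate_le_conjugate_of_nonneg hAS hH0
    rwa [show H * S * H = S * S by rw [← hHH]; simp only [Matrix.mul_assoc]] at this
  have hR0 := CFC.sqrt_nonneg (H * A * H)
  have hRR := sqrt_mul_sqrt hB
  -- Operator monotonicity of the square root. It yields `g R g ≤ g S g`, a projection, hence `G ≤
  -- 1`.
  have hRS : CFC.sqrt (H * A * H) ≤ S := by
    have h2 : CFC.sqrt (S * S) = S := CFC.sqrt_unique rfl hS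
    rw [← h2]
    open scoped Matrix.Norms.L2Operator in exact CFC.sqrt_le_sqrt _ _ hBle
  generalize CFC.sqrt (H * A * H) = R at hR0 hRR hRS
  have hRs := conjTranspose_of_nonneg hR0
  have hRQ : R * Q = 0 := by
    rw [← Matrix.conjTranspose_mul_self_eq_zero, Matrix.conjTranspose_mul, hRs, Matrix.mul_assoc,
      ← Matrix.mul_assoc R, hRR, Matrix.mul_assoc (H * A), hHQ, Matrix.mul_zero, Matrix.mul_zero]
  have hAQ : A * Q = 0 := by
    have hK := sqrt_mul_sqrt hA
    have hKs := conjTranspose_of_nonneg (CFC.sqrt_nonneg A)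
    generalize CFC.sqrt A = K at hK hKs
    have h1 : Q * A * Q = 0 := by
      refine le_antisymm ?_ ?_
      · have := star_left_conjugate_le_conjugate hAS Q
        rw [Matrix.star_eq_conjTranspose, hQs, ← hHH, Matrix.mul_assoc Q (H * H),
          Matrix.mul_assoc H, hHQ, Matrix.mul_zero, Matrix.mul_zero] at this
        exact this
      · have := star_left_conjugate_nonneg hA Q
        rwa [Matrix.star_eq_conjTranspose, hQs] at this
    have h2 : K * Q = 0 := by
      rw [← Matrix.conjTranspose_mul_self_eq_zero, Matrix.conjTranspose_mul, hKs, hQs,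
        Matrix.mul_assoc, ← Matrix.mul_assoc K, hK, ← Matrix.mul_assoc, h1]
    rw [← hK, Matrix.mul_assoc, h2, Matrix.mul_zero]
  have hAsupp : A * (H * g) = A := by
    rw [hQ, Matrix.mul_sub, Matrix.mul_one, sub_eq_zero] at hAQ
    exact hAQ.symm
  have hRsupp : R * (H * g) = R := by
    rw [hQ, Matrix.mul_sub, Matrix.mul_one, sub_eq_zero] at hRQ
    exact hRQ.symm
  have hsuppA : g * H * A = A := by
    have := congrArg Matrix.conjTranspose hAsupp
    rwa [Matrix.conjTranspose_mul, Matrix.conjTranspose_mul, hHs, hgs,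
      conjTranspose_of_nonneg hA] at this
  refine ⟨g * R * g, conjugate_nonneg_of_nonneg hR0 hg, ?_, ?_⟩
  · refine (conjugate_le_conjugate_of_nonneg hRS hg).trans ?_
    have : g * S * g = g * H := by
      rw [← hHH, ← Matrix.mul_assoc, hcomm, hHgH]
    rwa [this]
  · have h1 : g * S * g = H * g := by
      rw [← hHH, ← Matrix.mul_assoc, hcomm, hHgH]
    calc g * R * g * S * (g * R * g) = g * (R * (g * S * g) * R) * g := by
          simp only [Matrix.mul_assoc]
      _ = (g * H * A) * (H * g) := by
          rw [h1, hRsupp, hRR]; simp only [Matrix.mul_assoc]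
      _ = A := by rw [hsuppA, hAsupp]

/-- Take `P` to be the spectral projection of `B` onto `(0, ∞)`; then `P * B` is the positive part
of `B`. -/
theorem exists_positivePart {B : Matrix d d ℂ} (hB : IsSelfAdjoint B) :
    ∃ P : Matrix d d ℂ, 0 ≤ P ∧ P ≤ 1 ∧ 0 ≤ P * B ∧ B ≤ P * B := by
  have hc : ∀ f : ℝ → ℝ, ContinuousOn f (spectrum ℝ B) := fun f =>
    (Matrix.finite_real_spectrum (A := B)).continuousOn f
  have hid : cfc (fun x : ℝ => x) B = B := cfc_id' ℝ B
  have hm : cfc (fun x : ℝ => if 0 < x then (1 : ℝ) else 0) B * B =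
      cfc (fun x : ℝ => (if 0 < x then (1 : ℝ) else 0) * x) B := by
    rw [cfc_mul _ (fun x => x) B (hc _) (hc _), hid]
  refine ⟨cfc (fun x : ℝ => if 0 < x then (1 : ℝ) else 0) B, cfc_nonneg fun x _ => ?_,
    cfc_le_one _ _ fun x _ => ?_, ?_, ?_⟩
  · split_ifs <;> simp
  · split_ifs <;> simp
  · rw [hm]
    refine cfc_nonneg fun x _ => ?_
    split_ifs with h
    · simpa using h.le
    · simp
  · rw [hm]
    conv_lhs => rw [← hid]
    refine cfc_mono (fun x _ => ?_) (hc _) (hc _)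
    split_ifs with h
    · simp
    · simpa using not_lt.mp h

end MatrixLemmas

end PrivacyAmplification

namespace PrivacyAmplification

/-! ### Outcome weights and truncation of classical distributions. -/

section Classical

variable {d : Type*} [Fintype d] [DecidableEq d]

theorem outcomeDist_nonneg {n : ℕ} {M : Fin n → Matrix d d ℂ} (hM : IsPOVM M)
    {A : Matrix d d ℂ} (hA : 0 ≤ A) (i : Fin n) : 0 ≤ outcomeDist M A i :=
  re_trace_mul_nonneg (hM.1 i) hA

theorem sum_outcomeDist {n : ℕ} {M : Fin n → Matrix d d ℂ} (hM : IsPOVM M)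
    (A : Matrix d d ℂ) : ∑ i, outcomeDist M A i = A.trace.re := by
  simp only [outcomeDist]
  rw [← Complex.re_sum, ← Matrix.trace_sum, ← Matrix.sum_mul, hM.2, Matrix.one_mul]

theorem outcomeDist_le {n : ℕ} {M : Fin n → Matrix d d ℂ} (hM : IsPOVM M)
    {A B : Matrix d d ℂ} {l : ℝ} (h : A ≤ l • B) (i : Fin n) :
    outcomeDist M A i ≤ l * outcomeDist M B i := by
  have := re_trace_mul_le_mul_left h (hM.1 i)
  rwa [Matrix.mul_smul, Matrix.trace_smul, Complex.smul_re] at this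

theorem classicalState_le {n : ℕ} {p q : Fin n → ℝ} {l : ℝ} (h : ∀ i, p i ≤ l * q i) :
    classicalState p ≤ l • classicalState q := by
  rw [Matrix.le_iff, classicalState, classicalState, ← Matrix.diagonal_smul, Matrix.diagonal_sub,
    Matrix.posSemidef_diagonal_iff]
  intro i
  have : (0 : ℂ) ≤ ((l * q i - p i : ℝ) : ℂ) := Complex.zero_le_real.mpr (by linarith [h i])
  simpa using this

theorem plusNorm_classicalState_sub_le {n : ℕ} {p q : Fin n → ℝ} (h : ∀ i, q i ≤ p i) :
    plusNorm (classicalState p - classicalState q) ≤ ∑ i, (p i - q i) := by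
  obtain ⟨M, h0, h1, hM⟩ := (plusNorm_isGreatest (classicalState p - classicalState q)).1
  rw [hM, classicalState, classicalState, Matrix.diagonal_sub, Matrix.trace]
  refine (norm_sum_le _ _).trans (Finset.sum_le_sum fun i _ => ?_)
  have hn : ‖((p i : ℂ) - (q i : ℂ))‖ = p i - q i := by
    rw [← Complex.ofReal_sub, Complex.norm_real, Real.norm_of_nonneg (by linarith [h i])]
  rw [Matrix.diag_apply, Matrix.mul_diagonal, norm_mul, hn]
  have hd0 : 0 ≤ M i i := (Matrix.nonneg_iff_posSemidef.mp h0).diag_nonneg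
  have hd1 : 0 ≤ 1 - M i i := by
    have := (Matrix.le_iff.mp h1).diag_nonneg (i := i)
    rwa [Matrix.sub_apply, Matrix.one_apply_eq] at this
  have : ‖M i i‖ ≤ 1 := by
    rw [Complex.eq_coe_norm_of_nonneg hd0] at hd1
    simpa using (Complex.le_def.mp hd1).1
  exact mul_le_of_le_one_left (by linarith [h i]) this

/-- A distribution that is close to `q` in fidelity is close in trace distance to a sub-distribution
dominated by a multiple of `q`. -/
theorem sum_sub_min_le {ι : Type*} [Fintype ι] {p q : ι → ℝ} (hp : ∀ i, 0 ≤ p i)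
    (hq : ∀ i, 0 ≤ q i) (hp1 : ∑ i, p i = 1) (hq1 : ∑ i, q i ≤ 1) {ε η : ℝ} (hε : 0 < ε)
    (hε1 : ε < 1) (hη : ε < η) (hF : 1 - ε ≤ (∑ i, √(p i) * √(q i)) ^ 2) :
    ∑ i, (p i - min (p i) ((1 - ε) * η / (η - ε) * q i)) ≤ η := by
  classical
  have hη0 : 0 < η := hε.trans hη
  have hd : 0 < η - ε := sub_pos.mpr hη
  set c := (1 - ε) * η / (η - ε) with hc
  set a := ∑ i, if c * q i < p i then p i else 0 with ha
  set β := ∑ i, if c * q i < p i then q i else 0 with hβ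
  set s := η / (η - ε) with hs
  have hs0 : 0 < s := div_pos hη0 hd
  have hβ0 : 0 ≤ β := Finset.sum_nonneg fun i _ => by split_ifs; exacts [hq i, le_rfl]
  have ha1 : a ≤ 1 := by
    rw [← hp1]
    exact Finset.sum_le_sum fun i _ => by split_ifs; exacts [le_rfl, hp i]
  have hsum : ∑ i, (p i - min (p i) (c * q i)) = a - c * β := by
    rw [ha, hβ, Finset.mul_sum, ← Finset.sum_sub_distrib]
    refine Finset.sum_congr rfl fun i _ => ?_
    split_ifs with h
    · rw [min_eq_right h.le]
    · rw [min_eq_left (not_lt.mp h)]; ring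
  rw [hsum]
  -- On the set where `p` exceeds `c q`, `p` is divided by `s` and `q` multiplied by `s`, which
  -- leaves their products unchanged. The value of `s` is chosen so that `1 - 1/s = ε/η`.
  have hCS := Finset.sum_sq_le_sum_mul_sum_of_sq_le_mul Finset.univ
    (r := fun i => √(p i) * √(q i))
    (f := fun i => if c * q i < p i then p i / s else p i)
    (g := fun i => if c * q i < p i then s * q i else q i)
    (fun i _ => by split_ifs; exacts [div_nonneg (hp i) hs0.le, hp i])
    (fun i _ => by split_ifs; exacts [mul_nonneg hs0.le (hq i), hq i])
    (fun i _ => by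
      rw [mul_pow, Real.sq_sqrt (hp i), Real.sq_sqrt (hq i)]
      split_ifs
      · exact le_of_eq (by field_simp)
      · exact le_rfl)
  have h1 : ∑ i, (if c * q i < p i then p i / s else p i) = 1 - ε / η * a := by
    rw [← hp1, ha, Finset.mul_sum, ← Finset.sum_sub_distrib]
    refine Finset.sum_congr rfl fun i _ => ?_
    split_ifs
    · rw [hs]; field_simp
    · simp
  have h2 : ∑ i, (if c * q i < p i then s * q i else q i) ≤ 1 + ε / (η - ε) * β := by
    have : ∑ i, (if c * q i < p i then s * q i else q i) = ∑ i, q i + ε / (η - ε) * β := by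
      rw [hβ, Finset.mul_sum, ← Finset.sum_add_distrib]
      refine Finset.sum_congr rfl fun i _ => ?_
      split_ifs
      · rw [hs]; field_simp; ring
      · simp
    linarith
  have hεη : ε / η < 1 := (div_lt_one hη0).mpr hη
  have hεη0 : 0 < ε / η := div_pos hε hη0
  rw [h1] at hCS
  have hfac : 0 ≤ 1 - ε / η * a := by nlinarith
  have h3 : 1 - ε ≤ (1 - ε / η * a) * (1 + ε / (η - ε) * β) :=
    (hF.trans hCS).trans (mul_le_mul_of_nonneg_left h2 hfac)
  -- If `a > η + c β`, the first factor is below `(1 - ε)(1 - y)`, so the product is below `(1 -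
  -- ε)(1 - y²) ≤ 1 - ε`.
  by_contra! hlt
  set y := ε / (η - ε) * β with hy
  have hy0 : 0 ≤ y := mul_nonneg (div_nonneg hε.le hd.le) hβ0
  have h4 : 1 - ε / η * a < (1 - ε) * (1 - y) := by
    have h5 : ε / η * (η + c * β) < ε / η * a := mul_lt_mul_of_pos_left (by linarith) hεη0
    have h6 : ε / η * (η + c * β) = ε + (1 - ε) * y := by
      rw [hy, hc]; field_simp
    linarith
  nlinarith [mul_lt_mul_of_pos_right h4 (by linarith : 0 < 1 + y),
    mul_nonneg (sub_pos.mpr hε1).le (sq_nonneg y)]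

end Classical

/-! ### Extended logarithms and bounds on the max-relative entropy. -/

section Logarithms

variable {b : ℝ}

theorem elogb_coe {l : ℝ≥0} (hl : l ≠ 0) : elogb b l = ((Real.logb b l : ℝ) : EReal) := by
  rw [elogb, ENNReal.log_of_nnreal hl, ← EReal.coe_div, Real.logb]

theorem elogb_zero (hb : 1 < b) : elogb b 0 = ⊥ := by
  rw [elogb, ENNReal.log_zero]
  exact EReal.bot_div_of_pos_ne_top (by exact_mod_cast Real.log_pos hb) (EReal.coe_ne_top _)

theorem elogb_mono (hb : 1 < b) : Monotone (elogb b) := fun x y hxy => by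
  have : (0 : EReal) ≤ ((Real.log b : ℝ) : EReal) := by exact_mod_cast (Real.log_pos hb).le
  exact EReal.div_le_div_right_of_nonneg this (ENNReal.log_monotone hxy)

/-- The adjunction with the exponential, which lets a lower bound pass through the infimum inside
the logarithm in `Dmax`. -/
theorem le_elogb_iff (hb : 1 < b) {x : ℝ≥0∞} {y : EReal} :
    y ≤ elogb b x ↔ EReal.exp (y * ((Real.log b : ℝ) : EReal)) ≤ x := by
  rw [elogb, EReal.le_div_iff_mul_le (by exact_mod_cast Real.log_pos hb) (EReal.coe_ne_top _),
    ← EReal.exp_le_exp_iff, ENNReal.exp_log]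

theorem elogb_mul_le (hb : 1 < b) {c : ℝ≥0} (hc : c ≠ 0) (l : ℝ≥0) :
    elogb b ((c * l : ℝ≥0) : ℝ≥0∞) ≤ elogb b l + ((Real.logb b c : ℝ) : EReal) := by
  rcases eq_or_ne l 0 with rfl | hl
  · simp [elogb_zero hb]
  · rw [elogb_coe hl, elogb_coe (mul_ne_zero hc hl), NNReal.coe_mul,
      Real.logb_mul (by simpa using hc) (by simpa using hl), ← EReal.coe_add, add_comm]

variable {d : Type*} [Fintype d] [DecidableEq d]

theorem Dmax_le (hb : 1 < b) {A B : Matrix d d ℂ} {l : ℝ≥0} (h : A ≤ (l : ℝ) • B) :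
    Dmax b A B ≤ elogb b l :=
  elogb_mono hb (iInf₂_le l h)

theorem le_Dmax (hb : 1 < b) {A B : Matrix d d ℂ} {y : EReal}
    (h : ∀ l : ℝ≥0, A ≤ (l : ℝ) • B → y ≤ elogb b l) : y ≤ Dmax b A B :=
  (le_elogb_iff hb).mpr (le_iInf₂ fun l hl => (le_elogb_iff hb).mp (h l hl))

theorem neg_add_coe_le_neg_add_coe {x y : EReal} {r s t : ℝ} (h : y ≤ x + (t : EReal))
    (ht : t = s - r) : -x + (r : EReal) ≤ -y + (s : EReal) := by
  induction x with
  | bot =>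
    obtain rfl : y = ⊥ := by simpa using h
    simp
  | top => simp
  | coe x =>
    induction y with
    | bot => simp
    | top =>
      rw [← EReal.coe_add] at h
      exact absurd (top_le_iff.mp h) (EReal.coe_ne_top _)
    | coe y =>
      norm_cast at h ⊢
      linarith

end Logarithms

/-! ### Measured versus purified-distance smoothing. -/

section Measured

variable {d : Type*} [Fintype d] [DecidableEq d] {b ε η : ℝ}

theorem traceNorm_nonneg (A : Matrix d d ℂ) : 0 ≤ traceNorm A := by
  have h := (Complex.le_def.mp (trace_nonneg_of_nonneg (CFC.sqrt_nonneg (Aᴴ * A)))).1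
  rwa [Complex.zero_re] at h

theorem one_sub_le_fidelity_of_purifiedDist_le {ρ τ : Matrix d d ℂ} (hε : 0 ≤ ε)
    (h : purifiedDist ρ τ ≤ √ε) : 1 - ε ≤ fidelity ρ τ := by
  have := (Real.sqrt_le_sqrt_iff hε).mp h
  linarith

theorem DmaxM_le_DmaxP_add (hb : 1 < b) (hε : 0 < ε) (hε1 : ε < 1) (hη : ε < η)
    {ρ : Matrix d d ℂ} (hρ : 0 ≤ ρ) (hρ1 : ρ.trace = 1) (σ : Matrix d d ℂ) :
    DmaxM b η ρ σ ≤
      DmaxP b √ε ρ σ + ((Real.logb b ((1 - ε) * η / (η - ε)) : ℝ) : EReal) := by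
  have hd : 0 < η - ε := sub_pos.mpr hη
  have hc : 0 < (1 - ε) * η / (η - ε) := div_pos (mul_pos (by linarith) (by linarith)) hd
  obtain ⟨c, hc'⟩ : ∃ c : ℝ≥0, (c : ℝ) = (1 - ε) * η / (η - ε) := ⟨⟨_, hc.le⟩, rfl⟩
  have hc0 : c ≠ 0 := by rintro rfl; simp [← hc'] at hc
  refine iSup_le fun n => iSup₂_le fun M hM => ?_
  rw [← EReal.sub_le_iff_le_add (.inl (EReal.coe_ne_bot _)) (.inl (EReal.coe_ne_top _))]
  refine le_iInf₂ fun τ hτ => le_Dmax hb fun l hl => ?_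
  rw [EReal.sub_le_iff_le_add (.inl (EReal.coe_ne_bot _)) (.inl (EReal.coe_ne_top _)), ← hc']
  refine le_trans ?_ (elogb_mul_le hb hc0 l)
  obtain ⟨hτ0, hτ1, hP⟩ := hτ
  set p := outcomeDist M ρ
  set q := outcomeDist M τ
  have hp : ∀ i, 0 ≤ p i := outcomeDist_nonneg hM hρ
  have hq : ∀ i, 0 ≤ q i := outcomeDist_nonneg hM hτ0
  have hp1 : ∑ i, p i = 1 := by rw [sum_outcomeDist hM, hρ1, Complex.one_re]
  have hq1 : ∑ i, q i ≤ 1 := by rwa [sum_outcomeDist hM]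
  have hF : 1 - ε ≤ (∑ i, √(p i) * √(q i)) ^ 2 := by
    refine (one_sub_le_fidelity_of_purifiedDist_le hε.le hP).trans ?_
    exact pow_le_pow_left₀ (traceNorm_nonneg _) (traceNorm_sqrt_mul_sqrt_le hM hρ hτ0) 2
  have hmain := sum_sub_min_le hp hq hp1 hq1 hε hε1 hη hF
  rw [← hc'] at hmain
  -- The truncated distribution is the smoothing candidate; `τ ≤ l σ` survives the measurement and
  -- gives domination with constant `c * l`.
  refine (iInf₂_le (fun i => min (p i) (c * q i)) ⟨?_, ?_, ?_⟩).trans (Dmax_le hb ?_)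
  · refine classicalState_le fun i => (min_le_right _ _).trans ?_
    rw [NNReal.coe_mul, mul_assoc]
    exact mul_le_mul_of_nonneg_left (outcomeDist_le hM hl i) c.2
  · exact fun i => le_min (hp i) (mul_nonneg c.2 (hq i))
  · exact (Finset.sum_le_sum fun i _ => min_le_left _ _).trans hp1.le
  · exact (plusNorm_classicalState_sub_le fun i => min_le_left _ _).trans hmain

end Measured

/-! ### Calculus of block-diagonal operators. -/

/-- The block-diagonal operator `∑ₓ |x⟩⟨x| ⊗ Mₓ`. -/
def cqMatrix {X E : Type*} [DecidableEq X] (M : X → Matrix E E ℂ) : Matrix (X × E) (X × E) ℂ :=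
  (Matrix.blockDiagonal M).submatrix Prod.swap Prod.swap

section CQMatrix

variable {X E : Type*} [Fintype X] [DecidableEq X] [Fintype E] [DecidableEq E]

theorem cqMatrix_mul (M N : X → Matrix E E ℂ) :
    cqMatrix M * cqMatrix N = cqMatrix fun x => M x * N x := by
  rw [cqMatrix, cqMatrix, cqMatrix, Matrix.blockDiagonal_mul]
  exact Matrix.submatrix_mul_equiv _ _ _ (Equiv.prodComm X E) _

theorem cqMatrix_sub (M N : X → Matrix E E ℂ) :
    cqMatrix M - cqMatrix N = cqMatrix fun x => M x - N x :=
  congrArg (fun A => Matrix.submatrix A Prod.swap Prod.swap) (Matrix.blockDiagonal_sub M N).symm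

theorem cqMatrix_one : cqMatrix (fun _ : X => (1 : Matrix E E ℂ)) = 1 := by
  rw [cqMatrix]
  erw [Matrix.blockDiagonal_one]
  exact Matrix.submatrix_one _ Prod.swap_injective

theorem trace_cqMatrix (M : X → Matrix E E ℂ) : (cqMatrix M).trace = ∑ x, (M x).trace := by
  simp [Matrix.trace, cqMatrix, Fintype.sum_prod_type]

theorem cqMatrix_nonneg {M : X → Matrix E E ℂ} (h : ∀ x, 0 ≤ M x) : 0 ≤ cqMatrix M := by
  choose R hR using fun x => CStarAlgebra.nonneg_iff_eq_star_mul_self.mp (h x)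
  have e : cqMatrix M = (cqMatrix R)ᴴ * cqMatrix R := by
    have : (cqMatrix R)ᴴ = cqMatrix fun x => (R x)ᴴ := by
      rw [cqMatrix, Matrix.conjTranspose_submatrix, Matrix.blockDiagonal_conjTranspose, cqMatrix]
    rw [this, cqMatrix_mul]
    exact congrArg cqMatrix (funext hR)
  rw [e]
  exact Matrix.nonneg_iff_posSemidef.mpr (Matrix.posSemidef_conjTranspose_mul_self _)

theorem cqMatrix_mono {M N : X → Matrix E E ℂ} (h : ∀ x, M x ≤ N x) :
    cqMatrix M ≤ cqMatrix N := by
  rw [← sub_nonneg, cqMatrix_sub]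
  exact cqMatrix_nonneg fun x => sub_nonneg.mpr (h x)

theorem sum_single_kronecker (M : X → Matrix E E ℂ) :
    ∑ x, Matrix.single x x (1 : ℂ) ⊗ₖ M x = cqMatrix M := by
  ext ⟨x, i⟩ ⟨y, j⟩
  simp only [Matrix.sum_apply, Matrix.kroneckerMap_apply, Matrix.single_apply, cqMatrix,
    Matrix.submatrix_apply, Prod.swap_prod_mk, Matrix.blockDiagonal_apply, ite_mul, one_mul, zero_mul]
  by_cases h : x = y
  · subst h; simp
  · rw [if_neg h]
    refine Finset.sum_eq_zero fun z _ => if_neg ?_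
    rintro ⟨rfl, rfl⟩
    exact h rfl

theorem smul_one_kronecker (c : ℝ) (A : Matrix E E ℂ) :
    (c • (1 : Matrix X X ℂ)) ⊗ₖ A = cqMatrix fun _ => c • A := by
  ext ⟨x, i⟩ ⟨y, j⟩
  by_cases h : x = y
  · subst h; simp [cqMatrix]
  · simp [cqMatrix, Matrix.blockDiagonal_apply, h]

end CQMatrix

end PrivacyAmplification

namespace PrivacyAmplification

/-! ### From a compressing test to a nearby normalised state. -/

section Substate

variable {d : Type*} [Fintype d] [DecidableEq d] {ε : ℝ}

theorem mul_self_le_self {G : Matrix d d ℂ} (h0 : 0 ≤ G) (h1 : G ≤ 1) : G * G ≤ G := by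
  have h := conjugate_le_conjugate_of_nonneg h1 (CFC.sqrt_nonneg G)
  have hR := sqrt_mul_sqrt h0
  generalize CFC.sqrt G = R at h hR
  rwa [Matrix.mul_one, hR, show R * G * R = G * G by rw [← hR]; simp only [Matrix.mul_assoc]] at h

theorem traceNorm_sqrt_mul_sqrt_smul {ρ τ : Matrix d d ℂ} (hτ : 0 ≤ τ) {c : ℝ} (hc : 0 ≤ c) :
    traceNorm (CFC.sqrt ρ * CFC.sqrt (c • τ)) = √c * traceNorm (CFC.sqrt ρ * CFC.sqrt τ) := by
  have h1 : CFC.sqrt (c • τ) = √c • CFC.sqrt τ := by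
    refine CFC.sqrt_unique ?_ (smul_nonneg (Real.sqrt_nonneg c) (CFC.sqrt_nonneg τ))
    rw [Matrix.smul_mul, Matrix.mul_smul, smul_smul, Real.mul_self_sqrt hc, sqrt_mul_sqrt hτ]
  rw [h1, Matrix.mul_smul]
  generalize CFC.sqrt ρ * CFC.sqrt τ = A
  have hAA : 0 ≤ Aᴴ * A :=
    Matrix.nonneg_iff_posSemidef.mpr (Matrix.posSemidef_conjTranspose_mul_self A)
  have h2 : CFC.sqrt ((√c • A)ᴴ * (√c • A)) = √c • CFC.sqrt (Aᴴ * A) := by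
    refine CFC.sqrt_unique ?_ (smul_nonneg (Real.sqrt_nonneg c) (CFC.sqrt_nonneg _))
    rw [Matrix.smul_mul, Matrix.mul_smul, sqrt_mul_sqrt hAA, Matrix.conjTranspose_smul,
      star_trivial, Matrix.smul_mul, Matrix.mul_smul]
  rw [traceNorm, h2, Matrix.trace_smul, Complex.smul_re, traceNorm, smul_eq_mul]

/-- If `G ρ G ≤ A` for a test `0 ≤ G ≤ 1` with `Tr G²ρ ≥ 1 - ε`, then some state within purified
distance `√ε` of `ρ` is dominated by `A / (1 - ε)`. -/
theorem exists_state_near_le {ρ G A : Matrix d d ℂ} (hρ : 0 ≤ ρ) (hG : 0 ≤ G) (hG1 : G ≤ 1)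
    (hA : 0 ≤ A) (hGA : G * ρ * G ≤ A) (hε : ε < 1) (hGρ : 1 - ε ≤ (G * ρ * G).trace.re) :
    ∃ τ : Matrix d d ℂ, 0 ≤ τ ∧ τ.trace.re ≤ 1 ∧ purifiedDist ρ τ ≤ √ε ∧
      τ ≤ (1 / (1 - ε)) • A := by
  have hT : 0 ≤ G * ρ * G := conjugate_nonneg_of_nonneg hρ hG
  set t := (G * ρ * G).trace.re with ht
  have hε' : 0 < 1 - ε := by linarith
  have ht0 : 0 < t := by linarith
  refine ⟨t⁻¹ • (G * ρ * G), smul_nonneg (inv_nonneg.mpr ht0.le) hT, ?_, ?_, ?_⟩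
  · rw [Matrix.trace_smul, Complex.smul_re, ← ht, smul_eq_mul, inv_mul_cancel₀ ht0.ne']
  · refine Real.sqrt_le_sqrt ?_
    rw [fidelity, traceNorm_sqrt_mul_sqrt_smul hT (inv_nonneg.mpr ht0.le), mul_pow,
      Real.sq_sqrt (inv_nonneg.mpr ht0.le)]
    -- From `G² ≤ G`; hence the fidelity with the normalised state is at least `t⁻¹ t² = t`.
    have h1 : t ≤ (G * ρ).trace.re := by
      have := re_trace_mul_le_mul_left (mul_self_le_self hG hG1) hρ
      rwa [Matrix.trace_mul_comm ρ G, ← Matrix.mul_assoc, Matrix.trace_mul_comm (ρ * G),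
        ← Matrix.mul_assoc, ← ht] at this
    have h2 := h1.trans (re_trace_mul_le_traceNorm_sqrt hρ hG)
    have h3 : t ≤ t⁻¹ * traceNorm (CFC.sqrt ρ * CFC.sqrt (G * ρ * G)) ^ 2 := by
      rw [inv_mul_eq_div, le_div_iff₀ ht0, sq]
      exact mul_self_le_mul_self ht0.le h2
    linarith
  · calc t⁻¹ • (G * ρ * G) ≤ t⁻¹ • A := smul_le_smul_of_nonneg_left hGA (inv_nonneg.mpr ht0.le)
      _ ≤ (1 / (1 - ε)) • A := by
        refine smul_le_smul_of_nonneg_right ?_ hA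
        rw [one_div]
        exact inv_anti₀ hε' hGρ

end Substate

/-! ### Hashing of classical-quantum states and the two inequalities. -/

namespace CQState

variable {X E : Type*} [Fintype X] [DecidableEq X] [Fintype E] [DecidableEq E]

theorem weighted_nonneg (ρ : CQState X E) (x : X) : 0 ≤ ρ.p x • ρ.ρE x :=
  smul_nonneg (ρ.p_nonneg x) (ρ.ρE_nonneg x)

theorem toMatrix_eq (ρ : CQState X E) : ρ.toMatrix = cqMatrix fun x => ρ.p x • ρ.ρE x :=
  sum_single_kronecker _

theorem toMatrix_nonneg (ρ : CQState X E) : 0 ≤ ρ.toMatrix := by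
  rw [toMatrix_eq]
  exact cqMatrix_nonneg ρ.weighted_nonneg

theorem trace_toMatrix (ρ : CQState X E) : ρ.toMatrix.trace = 1 := by
  rw [toMatrix_eq, trace_cqMatrix]
  simp only [Matrix.trace_smul, ρ.ρE_trace]
  rw [← Finset.sum_smul, ρ.p_sum, one_smul]

/-- Subtracting from the hashed state its part exceeding `ρ_E / n` costs at most the hash error. -/
theorem exists_excess (ρ : CQState X E) {n : ℕ} (f : X → Fin n) :
    ∃ Q : Fin n → Matrix E E ℂ, (∀ z, 0 ≤ Q z) ∧
      (∀ z, ∑ x with f x = z, ρ.p x • ρ.ρE x ≤ (n : ℝ)⁻¹ • partialTrace ρ.toMatrix + Q z) ∧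
      ∑ z, (Q z).trace.re ≤ ρ.hashError f := by
  have hE : 0 ≤ partialTrace ρ.toMatrix := by
    rw [partialTrace_toMatrix]
    exact Finset.sum_nonneg fun x _ => ρ.weighted_nonneg x
  set A := (n : ℝ)⁻¹ • partialTrace ρ.toMatrix with hA
  have hA0 : 0 ≤ A := smul_nonneg (by positivity) hE
  set B : Fin n → Matrix E E ℂ := fun z => ∑ x with f x = z, ρ.p x • ρ.ρE x - A with hB
  have hBs : ∀ z, IsSelfAdjoint (B z) := fun z =>
    (IsSelfAdjoint.of_nonneg (Finset.sum_nonneg fun x _ => ρ.weighted_nonneg x)).sub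
      (IsSelfAdjoint.of_nonneg hA0)
  choose P hP0 hP1 hPB0 hPB using fun z => exists_positivePart (hBs z)
  refine ⟨fun z => P z * B z, hPB0, fun z => sub_le_iff_le_add'.mp (hPB z), ?_⟩
  have hdiff : ρ.hashed f - ((n : ℝ)⁻¹ • (1 : Matrix (Fin n) (Fin n) ℂ)) ⊗ₖ
      partialTrace ρ.toMatrix = cqMatrix B := by
    rw [hashed, sum_single_kronecker, smul_one_kronecker, cqMatrix_sub]
  have hM1 : cqMatrix P ≤ 1 := by
    rw [← cqMatrix_one]
    exact cqMatrix_mono hP1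
  -- The block-diagonal positive projection is an admissible test for the hash error.
  have hle := (plusNorm_isGreatest (cqMatrix B)).2 ⟨cqMatrix P, cqMatrix_nonneg hP0, hM1, rfl⟩
  rw [hashError, hdiff]
  refine le_trans ?_ hle
  rw [cqMatrix_mul, trace_cqMatrix, ← Complex.re_sum]
  exact Complex.re_le_norm _

theorem exists_hashError_le {ε : ℝ} {ρ : CQState X E} {n : ℕ} (h : ρ.Extractable ε n) :
    ∃ f : X → Fin n, ρ.hashError f ≤ ε := by
  obtain ⟨μ, hμ⟩ := h
  have hs : ∑ f, (μ f).toReal = 1 := by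
    rw [← ENNReal.toReal_sum fun f _ => μ.apply_ne_top f,
      ← tsum_fintype (L := .unconditional _), μ.tsum_coe, ENNReal.toReal_one]
  by_contra! hlt
  obtain ⟨g, hg⟩ : ∃ g, 0 < (μ g).toReal := by
    by_contra! hle
    have := Finset.sum_nonpos fun g (_ : g ∈ Finset.univ) => hle g
    linarith
  have : ∑ f, (μ f).toReal * ε < ∑ f, (μ f).toReal * ρ.hashError f :=
    Finset.sum_lt_sum
      (fun f _ => mul_le_mul_of_nonneg_left (hlt f).le ENNReal.toReal_nonneg)
      ⟨g, Finset.mem_univ g, mul_lt_mul_of_pos_left (hlt g) hg⟩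
  rw [← Finset.sum_mul, hs, one_mul] at this
  linarith

/-- The compression is built on the hash values and pulled back to `X` along `f`: each weighted
state lies below its whole fibre sum, so the test for the fibre also brings it below `ρ_E / n`. -/
theorem exists_state_near_le_of_hashError_le {ε : ℝ} (hε : ε < 1) (ρ : CQState X E) {n : ℕ}
    (hn : 0 < n) {f : X → Fin n} (hf : ρ.hashError f ≤ ε) :
    ∃ τ : Matrix (X × E) (X × E) ℂ, 0 ≤ τ ∧ τ.trace.re ≤ 1 ∧ purifiedDist ρ.toMatrix τ ≤ √ε ∧
      τ ≤ (1 / (1 - ε) * (n : ℝ)⁻¹) • ((1 : Matrix X X ℂ) ⊗ₖ partialTrace ρ.toMatrix) := by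
  obtain ⟨Q, hQ0, hQle, hQ⟩ := ρ.exists_excess f
  have hEtr : (partialTrace ρ.toMatrix).trace = 1 := by
    rw [← ρ.trace_toMatrix, toMatrix_eq, trace_cqMatrix, ← toMatrix_eq, partialTrace_toMatrix,
      Matrix.trace_sum]
  have hE : 0 ≤ partialTrace ρ.toMatrix := by
    rw [partialTrace_toMatrix]
    exact Finset.sum_nonneg fun x _ => ρ.weighted_nonneg x
  set A := (n : ℝ)⁻¹ • partialTrace ρ.toMatrix with hA
  have hA0 : 0 ≤ A := smul_nonneg (by positivity) hE
  choose G hG0 hG1 hG using fun z => exists_riccati hA0 (le_add_of_nonneg_right (hQ0 z))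
  -- The trace lost is `Tr (1 - G²) ρ_z ≤ Tr (1 - G²) S_z = Tr S_z - Tr A = Tr Q_z`, by the Riccati
  -- equation.
  have hbound : ∀ z, (∑ x with f x = z, ρ.p x • ρ.ρE x).trace.re -
      (G z * (∑ x with f x = z, ρ.p x • ρ.ρE x) * G z).trace.re ≤ (Q z).trace.re := by
    intro z
    have hGG := (mul_self_le_self (hG0 z) (hG1 z)).trans (hG1 z)
    have h := re_trace_mul_le_mul_left (hQle z) (sub_nonneg.mpr hGG)
    have key : ∀ S : Matrix E E ℂ,
        ((1 - G z * G z) * S).trace.re = S.trace.re - (G z * S * G z).trace.re := by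
      intro S
      rw [Matrix.sub_mul, Matrix.one_mul, Matrix.trace_sub, Complex.sub_re,
        Matrix.mul_assoc (G z) (G z), Matrix.trace_mul_comm (G z)]
    rw [key, key, hG, Matrix.trace_add, Complex.add_re] at h
    linarith
  have hconj : (cqMatrix fun x => G (f x)) * ρ.toMatrix * (cqMatrix fun x => G (f x)) =
      cqMatrix fun x => G (f x) * (ρ.p x • ρ.ρE x) * G (f x) := by
    rw [toMatrix_eq, cqMatrix_mul, cqMatrix_mul]
  have htarget : (1 / (1 - ε) * (n : ℝ)⁻¹) • ((1 : Matrix X X ℂ) ⊗ₖ partialTrace ρ.toMatrix) =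
      (1 / (1 - ε)) • cqMatrix fun _ : X => A := by
    rw [hA, ← smul_one_kronecker, mul_smul, Matrix.smul_kronecker]
  rw [htarget]
  refine exists_state_near_le (G := cqMatrix fun x => G (f x)) ρ.toMatrix_nonneg
    (cqMatrix_nonneg fun x => hG0 (f x)) ?_ (cqMatrix_nonneg fun _ => hA0) ?_ hε ?_
  · rw [← cqMatrix_one]
    exact cqMatrix_mono fun x => hG1 (f x)
  · rw [hconj]
    refine cqMatrix_mono fun x => ?_
    rw [← hG (f x)]
    refine conjugate_le_conjugate_of_nonneg (le_trans ?_ (hQle (f x))) (hG0 (f x))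
    exact Finset.single_le_sum (f := fun y => ρ.p y • ρ.ρE y) (fun y _ => ρ.weighted_nonneg y)
      (Finset.mem_filter.mpr ⟨Finset.mem_univ x, rfl⟩)
  · rw [hconj, trace_cqMatrix, ← Finset.sum_fiberwise (s := Finset.univ) (g := f), Complex.re_sum]
    have h1 : ∀ z, ∑ x with f x = z, (G (f x) * (ρ.p x • ρ.ρE x) * G (f x)).trace =
        (G z * (∑ x with f x = z, ρ.p x • ρ.ρE x) * G z).trace := by
      intro z
      rw [Matrix.mul_sum, Matrix.sum_mul, Matrix.trace_sum]
      refine Finset.sum_congr rfl fun x hx => ?_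
      rw [(Finset.mem_filter.mp hx).2]
    simp only [h1]
    have h2 : ∑ z, (∑ x with f x = z, ρ.p x • ρ.ρE x).trace.re = 1 := by
      rw [← Complex.re_sum, ← Matrix.trace_sum, Finset.sum_fiberwise, ← partialTrace_toMatrix, hEtr,
        Complex.one_re]
    have h3 := Finset.sum_le_sum fun z (_ : z ∈ Finset.univ) => hbound z
    rw [Finset.sum_sub_distrib, h2] at h3
    linarith

/-- The weights sum to one, so `X` is nonempty and admits no map to an empty alphabet. This excludes
`n = 0`, where `Real.logb` has the default value `0`. -/
theorem Extractable.pos {ε : ℝ} {ρ : CQState X E} {n : ℕ} (h : ρ.Extractable ε n) : 0 < n := by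
  obtain ⟨f, -⟩ := exists_hashError_le h
  have : Nonempty X := by
    by_contra hX
    rw [not_nonempty_iff] at hX
    simpa using ρ.p_sum
  exact Fin.pos (f this.some)

theorem extractableRandomness_le_HminPDown {b ε : ℝ} (hb : 1 < b) (hε1 : ε < 1)
    (ρ : CQState X E) :
    ρ.extractableRandomness b ε ≤
      HminPDown b √ε ρ.toMatrix + ((Real.logb b (1 / (1 - ε)) : ℝ) : EReal) := by
  refine sSup_le ?_
  rintro _ ⟨n, hn, rfl⟩
  have hn0 := hn.pos
  obtain ⟨f, hf⟩ := exists_hashError_le hn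
  obtain ⟨τ, hτ0, hτ1, hP, hle⟩ := ρ.exists_state_near_le_of_hashError_le hε1 hn0 hf
  have hc : 0 < 1 - ε := by linarith
  have hn' : (0 : ℝ) < n := by exact_mod_cast hn0
  have hl : 0 < 1 / (1 - ε) * (n : ℝ)⁻¹ := by positivity
  obtain ⟨l, hl'⟩ : ∃ l : ℝ≥0, (l : ℝ) = 1 / (1 - ε) * (n : ℝ)⁻¹ := ⟨⟨_, hl.le⟩, rfl⟩
  rw [← hl'] at hle
  have hl0 : l ≠ 0 := fun h => hl.ne' (by rw [← hl', h, NNReal.coe_zero])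
  have hD : DmaxP b √ε ρ.toMatrix ((1 : Matrix X X ℂ) ⊗ₖ partialTrace ρ.toMatrix) ≤
      ((Real.logb b l : ℝ) : EReal) :=
    (iInf₂_le τ ⟨hτ0, hτ1, hP⟩).trans ((Dmax_le hb hle).trans_eq (elogb_coe hl0))
  have hlog : Real.logb b n = -Real.logb b l + Real.logb b (1 / (1 - ε)) := by
    rw [hl', Real.logb_mul (by positivity) (by positivity), Real.logb_inv]
    ring
  rw [hlog, EReal.coe_add, EReal.coe_neg, HminPDown]
  exact add_le_add_left (EReal.neg_le_neg_iff.mpr hD) _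

theorem HminPDown_add_le_HminMDown_add {b ε η : ℝ} (hb : 1 < b) (hε : 0 < ε) (hε1 : ε < 1)
    (hη : ε < η) (ρ : CQState X E) :
    HminPDown b √ε ρ.toMatrix + ((Real.logb b (1 / (1 - ε)) : ℝ) : EReal) ≤
      HminMDown b η ρ.toMatrix + ((Real.logb b (η / (η - ε)) : ℝ) : EReal) := by
  refine neg_add_coe_le_neg_add_coe
    (DmaxM_le_DmaxP_add hb hε hε1 hη ρ.toMatrix_nonneg ρ.trace_toMatrix _) ?_
  have h1 : 1 - ε ≠ 0 := by linarith
  have h2 : η / (η - ε) ≠ 0 := (div_pos (hε.trans hη) (sub_pos.mpr hη)).ne'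
  -- The truncation constant factors as `(1 - ε)` times `η / (η - ε)`, and the first factor cancels
  -- the term `log (1 / (1 - ε))`.
  rw [mul_div_assoc, Real.logb_mul h1 h2, one_div, Real.logb_inv]
  ring

end CQState

end PrivacyAmplification

theorem mainTheorem4 {X E : Type*} [Fintype X] [DecidableEq X] [Fintype E] [DecidableEq E]
    (b : ℝ) (hb : 1 < b) (ρ : CQState X E) (ε : ℝ) (hε : ε ∈ Set.Ioo (0 : ℝ) 1) :
    (∀ δ ∈ Set.Ioo (0 : ℝ) (1 - ε),
      ρ.extractableRandomness b ε
          ≤ HminPDown b (Real.sqrt ε) ρ.toMatrix + ((Real.logb b (1 / (1 - ε)) : ℝ) : EReal) ∧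
      HminPDown b (Real.sqrt ε) ρ.toMatrix + ((Real.logb b (1 / (1 - ε)) : ℝ) : EReal)
          ≤ HminMDown b (ε + δ) ρ.toMatrix + ((Real.logb b ((ε + δ) / δ) : ℝ) : EReal)) ∧
    (∀ k ∈ Set.Ioo (1 : ℝ) (1 / ε),
      ρ.extractableRandomness b ε
          ≤ HminMDown b (k * ε) ρ.toMatrix + ((Real.logb b (k / (k - 1)) : ℝ) : EReal)) := by
  have h1 := ρ.extractableRandomness_le_HminPDown hb hε.2
  -- Both remaining bounds are the same inequality, at `η = ε + δ` and at `η = k ε`.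
  refine ⟨fun δ hδ => ⟨h1, ?_⟩, fun k hk => h1.trans ?_⟩
  · have h2 := ρ.HminPDown_add_le_HminMDown_add hb hε.1 hε.2 (lt_add_of_pos_right ε hδ.1)
    rwa [add_sub_cancel_left] at h2
  · have h2 := ρ.HminPDown_add_le_HminMDown_add hb hε.1 hε.2 (lt_mul_of_one_lt_left hε.1 hk.1)
    have e : k * ε / (k * ε - ε) = k / (k - 1) := by
      rw [← sub_one_mul, mul_div_mul_right _ _ hε.1.ne']
    rwa [e] at h2
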